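/- All graphs are finite simple graphs. For a tree $T$ let $\ell(T)$ be the number of its leaves (vertices of degree $1$), and let $\nu_2(T)$ be its $2$-matching number, i.e. the maximum cardinality of a set $M\subseteq E(T)$ such that every vertex of $T$ is incident to at most $2$ edges of $M$. A *starlike tree* is a tree with exactly one vertex of degree at least $3$, its *central vertex*. If a tree $T$ has at least two vertices of degree at least $3$, a *starlike splitting* of $T$ is a $4$-tuple $(S,T',v_s,v_t)$ where $S$ is a starlike tree, $T'$ is a tree, $v_s$ is a leaf of $S$ adjacent to the central vertex of $S$, $v_t$ is a vertex of $T'$, and $T$ is (up to isomorphism) obtained from the disjoint union of $S$ and $T'$ by identifying $v_s$ with $v_t$. The splitting is *irregular* if $v_t$ has degree greater than $1$ in $T'$. A *starlike decomposition* of $T$ is obtained by a sequence of starlike splittings: if $T$ has at most one vertex of degree at least $3$, it consists of $T$ alone, with no splitting; otherwise it consists of $S$ and the members of a starlike decomposition of $T'$, for some starlike splitting $(S,T',v_s,v_t)$ of $T$. **Proposition.** Let $T$ be a finite tree with at least $2$ vertices. Then $T$ has a starlike decomposition, the number of irregular splittings is the same for every sequence of starlike splittings producing a starlike decomposition of $T$,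 and, denoting this number (the *splitting irregularity number* of $T$) by $\iota(T)$, $$\ell(T)-2-\iota(T)=|E(T)|-\nu_2(T).$$ -/

import Mathlib

universe u

namespace TreeSplitting

noncomputable section

/-- The degree of a vertex, as the number of its neighbours. -/
def deg {V : Type u} (G : SimpleGraph V) (v : V) : ℕ := (G.neighborSet v).ncard

theorem deg_eq_degree {V : Type u} (G : SimpleGraph V) (v : V) [Fintype (G.neighborSet v)] :
    deg G v = G.degree v := by
  rw [deg, Set.ncard_eq_toFinset_card', SimpleGraph.degree, SimpleGraph.neighborFinset]

/-- The number `ℓ(G)` of leaves, i.e. of vertices of degree `1`. -/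
def numLeaves {V : Type u} (G : SimpleGraph V) : ℕ := {v : V | deg G v = 1}.ncard

/-- The number `|E(G)|` of edges. -/
def numEdges {V : Type u} (G : SimpleGraph V) : ℕ := G.edgeSet.ncard

/-- A `2`-matching: a set of edges such that every vertex is incident to at most two of them. -/
def IsTwoMatching {V : Type u} (G : SimpleGraph V) (M : Set (Sym2 V)) : Prop :=
  M ⊆ G.edgeSet ∧ ∀ v : V, {e ∈ M | v ∈ e}.encard ≤ 2

/-- The `2`-matching number `ν₂(G)` of a finite graph: the largest size of a `2`-matching. -/
def twoMatchingNumber {V : Type u} (G : SimpleGraph V) : ℕ :=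
  sSup {n : ℕ | ∃ M : Set (Sym2 V), IsTwoMatching G M ∧ M.ncard = n}

/-- A starlike tree: a tree with exactly one vertex of degree at least `3`. -/
def IsStarlike {V : Type u} (G : SimpleGraph V) : Prop :=
  G.IsTree ∧ ∃! v : V, 3 ≤ deg G v

/-- `T` is obtained from `S` and `T'` by merging the vertex `vs` of `S` with the vertex `vt` of
`T'` (a wedge sum): up to isomorphism, `T` is the union of a copy of `S` and a copy of `T'` whose
only common vertex is `vs = vt`. -/
def IsMerge {V A B : Type u} (T : SimpleGraph V) (S : SimpleGraph A) (T' : SimpleGraph B)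
    (vs : A) (vt : B) : Prop :=
  ∃ (f : A ↪ V) (g : B ↪ V),
    (∀ a b, f a = g b ↔ a = vs ∧ b = vt) ∧
    Set.range f ∪ Set.range g = Set.univ ∧
    T = S.map f ⊔ T'.map g

/-- A starlike splitting `(S, T', v_s, v_t)` of a tree `T` with several vertices of degree at
least `3`. -/
structure StarlikeSplitting {V : Type u} (T : SimpleGraph V) : Type (u + 1) where
  /-- the vertices of `S` -/
  {A : Type u}
  /-- the vertices of `T'` -/
  {B : Type u}
  S : SimpleGraph A
  T' : SimpleGraph B
  vs : A
  vt : B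
  exists_two_high : ∃ x y : V, x ≠ y ∧ 3 ≤ deg T x ∧ 3 ≤ deg T y
  isStarlike : IsStarlike S
  isTree : T'.IsTree
  deg_vs : deg S vs = 1
  /-- `v_s` is adjacent to the central vertex of `S` -/
  adj_center : ∃ c : A, 3 ≤ deg S c ∧ S.Adj vs c
  isMerge : IsMerge T S T' vs vt

/-- A splitting is irregular if `v_t` has degree greater than `1` in `T'`. -/
def StarlikeSplitting.IsIrregular {V : Type u} {T : SimpleGraph V}
    (σ : StarlikeSplitting T) : Prop := 1 < deg σ.T' σ.vt

/-- A starlike decomposition of a tree, together with the sequence of starlike splittings that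
produces it: either the tree already has at most one vertex of degree at least `3` and is the only
piece, or it is split into `S` and `T'`, where `S` is a piece and the remaining pieces form a
starlike decomposition of `T'`. -/
inductive StarlikeDecomposition : {V : Type u} → SimpleGraph V → Type (u + 1)
  | last {V : Type u} {T : SimpleGraph V} (isTree : T.IsTree)
      (atMostOne : ∀ x y : V, 3 ≤ deg T x → 3 ≤ deg T y → x = y) : StarlikeDecomposition T
  | split {V : Type u} {T : SimpleGraph V} (isTree : T.IsTree) (σ : StarlikeSplitting T)
      (D : StarlikeDecomposition σ.T') : StarlikeDecomposition T

open Classical in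
/-- The number of irregular splittings in a starlike decomposition. -/
def StarlikeDecomposition.numIrregular :
    {V : Type u} → {T : SimpleGraph V} → StarlikeDecomposition T → ℕ
  | _, _, .last _ _ => 0
  | _, _, .split _ σ D => D.numIrregular + if σ.IsIrregular then 1 else 0

/-- The splitting irregularity number `ι(T)`: the number of irregular splittings in any starlike
decomposition of `T`. (A value is selected here by an infimum; that a decomposition exists and that
all of them give this value is part of the theorem.) -/
def splittingIrregularityNumber {V : Type u} (T : SimpleGraph V) : ℕ :=
  sInf (Set.range fun D : StarlikeDecomposition T => D.numIrregular)

end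

end TreeSplitting

/-! Call `|E| - ν₂` the deficiency. In a tree with a single vertex `c` of degree at least `3`, both
`ℓ - 2` and the deficiency equal `deg c - 2`; in a path both are `0`.

Under a splitting with centre `c`, edge numbers add. So do the `ν₂`: a `2`-matching of `T` restricts
to the parts, and conversely `S` has a maximum `2`-matching omitting the edge from `c` to `v_s`, so
it combines with any `2`-matching of `T'`. Hence the deficiency drops by `deg c - 2` from `T` to
`T'`. Merging costs the leaf `v_s`, and also the leaf `v_t` when the splitting is regular, so `ℓ`
drops by `deg c - 2`, plus `1` if irregular (`StarlikeSplitting.deficiency_eq`).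

Induction gives the formula for each decomposition (`numIrregular_eq`). All terms except the
irregularity count depend only on `T`, so independence comes for free. Existence follows by cutting
off a vertex of degree at least `3` farthest from another one. -/

namespace TreeSplitting

/-! ### `2`-matchings and leaves of trees with at most one high-degree vertex -/

section TwoMatching

variable {V : Type u} {G : SimpleGraph V}

theorem deg_eq_ncard_incidenceSet (G : SimpleGraph V) (v : V) :
    deg G v = (G.incidenceSet v).ncard := by
  classical
  exact Nat.card_congr (G.incidenceSetEquivNeighborSet v).symm

theorem twoMatching_ncard_le [Finite V] {M : Set (Sym2 V)} (hM : IsTwoMatching G M) :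
    M.ncard ≤ twoMatchingNumber G := by
  refine le_csSup ⟨G.edgeSet.ncard, ?_⟩ ⟨M, hM, rfl⟩
  rintro _ ⟨N, hN, rfl⟩
  exact Set.ncard_le_ncard hN.1 (Set.toFinite _)

/-- The empty matching and the bound `|E|` make the supremum in `ℕ` an attained maximum. -/
theorem exists_twoMatching_ncard_eq [Finite V] (G : SimpleGraph V) :
    ∃ M, IsTwoMatching G M ∧ M.ncard = twoMatchingNumber G := by
  refine Nat.sSup_mem (s := {n | ∃ M, IsTwoMatching G M ∧ M.ncard = n}) ?_ ?_
  · exact ⟨0, ∅, ⟨Set.empty_subset _, by simp⟩, by simp⟩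
  · refine ⟨G.edgeSet.ncard, ?_⟩
    rintro _ ⟨N, hN, rfl⟩
    exact Set.ncard_le_ncard hN.1 (Set.toFinite _)

theorem encard_le_two_iff [Finite V] (s : Set (Sym2 V)) : s.encard ≤ 2 ↔ s.ncard ≤ 2 := by
  rw [← (Set.toFinite s).cast_ncard_eq]
  exact_mod_cast Iff.rfl

theorem IsTwoMatching.ncard_incident_le [Finite V] {M : Set (Sym2 V)} (hM : IsTwoMatching G M)
    (v : V) : {e ∈ M | v ∈ e}.ncard ≤ 2 :=
  (encard_le_two_iff _).1 (hM.2 v)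

theorem ncard_incident_le_deg [Finite V] {M : Set (Sym2 V)} (hM : M ⊆ G.edgeSet) (v : V) :
    {e ∈ M | v ∈ e}.ncard ≤ deg G v := by
  rw [deg_eq_ncard_incidenceSet]
  exact Set.ncard_le_ncard (fun e he => ⟨hM he.1, he.2⟩) (Set.toFinite _)

/-- A `2`-matching omits all but at most two of the edges at any vertex. -/
theorem IsTwoMatching.ncard_add_deg_le [Finite V] {M : Set (Sym2 V)} (hM : IsTwoMatching G M)
    (c : V) : M.ncard + deg G c ≤ numEdges G + 2 := by
  have h1 : (M ∪ G.incidenceSet c).ncard ≤ numEdges G :=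
    Set.ncard_le_ncard (Set.union_subset hM.1 (G.incidenceSet_subset c)) (Set.toFinite _)
  have h2 := Set.ncard_union_add_ncard_inter M (G.incidenceSet c)
  have h3 : (M ∩ G.incidenceSet c).ncard ≤ 2 :=
    (Set.ncard_le_ncard (t := {e ∈ M | c ∈ e}) (fun e he => ⟨he.1, he.2.2⟩)
      (Set.toFinite _)).trans (hM.ncard_incident_le c)
  rw [deg_eq_ncard_incidenceSet]
  omega

/-- If `c` is the only vertex of degree at least `3`, omitting `deg c - 2` edges at `c`, among them
a prescribed one, gives a `2`-matching. -/
theorem exists_twoMatching_avoiding [Finite V] {c w : V} (hc : 3 ≤ deg G c)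
    (hlow : ∀ v, v ≠ c → deg G v ≤ 2) (hw : G.Adj c w) :
    ∃ M, IsTwoMatching G M ∧ s(c, w) ∉ M ∧ M.ncard + deg G c = numEdges G + 2 := by
  have hd := deg_eq_ncard_incidenceSet G c
  -- `R` is the set of omitted edges; `deg c ≥ 3` leaves room in it for `s(c, w)`.
  obtain ⟨R, hR1, hR2, hR3⟩ := Set.exists_subsuperset_card_eq (s := {s(c, w)})
    (t := G.incidenceSet c) (n := deg G c - 2) (by simpa using hw) (by simp; omega) (by omega)
  have hRE : R ⊆ G.edgeSet := hR2.trans (G.incidenceSet_subset c)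
  refine ⟨G.edgeSet \ R, ⟨Set.sdiff_subset, fun v => ?_⟩, ?_, ?_⟩
  · rw [encard_le_two_iff]
    by_cases hv : v = c
    · subst hv
      have : {e ∈ G.edgeSet \ R | v ∈ e} = G.incidenceSet v \ R := by
        ext e; simp only [Set.mem_sdiff, Set.mem_ofPred_eq, SimpleGraph.incidenceSet]; tauto
      have h := Set.ncard_sdiff_add_ncard_of_subset hR2 (Set.toFinite _)
      rw [this]; omega
    · exact (ncard_incident_le_deg Set.sdiff_subset v).trans (hlow v hv)
  · exact fun h => h.2 (hR1 rfl)
  · have h := Set.ncard_sdiff_add_ncard_of_subset hRE (Set.toFinite _)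
    rw [numEdges]; omega

theorem deg_pos_of_connected [Finite V] (hG : G.Connected) (hV : 2 ≤ Nat.card V) (v : V) :
    1 ≤ deg G v := by
  have := Fintype.ofFinite V
  classical
  have : Nontrivial V := Finite.one_lt_card_iff_nontrivial.1 hV
  rw [deg_eq_degree]
  exact hG.preconnected.degree_pos_of_nontrivial v

/-- In a tree, the degrees sum to twice the number of vertices minus two. -/
theorem sum_deg_sub_two [Fintype V] (hG : G.IsTree) : ∑ v, ((deg G v : ℤ) - 2) = -2 := by
  classical
  have h1 := G.sum_degrees_eq_twice_card_edges
  have h2 := hG.card_edgeFinset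
  simp only [deg_eq_degree, Finset.sum_sub_distrib, Finset.sum_const, Finset.card_univ]
  rw [← Nat.cast_sum, h1, ← h2]
  simp; ring

theorem numLeaves_eq_sum [Fintype V] (G : SimpleGraph V) :
    (numLeaves G : ℤ) = ∑ v, if deg G v = 1 then 1 else 0 := by
  classical
  rw [numLeaves, Set.ncard_eq_toFinset_card']
  simp

/-- In the sum of `deg v - 2`, which is `-2`, each leaf contributes `-1` and each vertex of degree
`2` nothing. -/
theorem numLeaves_eq_two [Finite V] (hG : G.IsTree) (hV : 2 ≤ Nat.card V)
    (hlow : ∀ v, deg G v ≤ 2) : numLeaves G = 2 := by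
  have := Fintype.ofFinite V
  have h := sum_deg_sub_two hG
  have h2 : ∑ v, ((deg G v : ℤ) - 2) = ∑ v, -(if deg G v = 1 then (1 : ℤ) else 0) := by
    refine Finset.sum_congr rfl fun v _ => ?_
    have := deg_pos_of_connected hG.connected hV v
    have := hlow v
    split_ifs <;> omega
  rw [h2, Finset.sum_neg_distrib, ← numLeaves_eq_sum] at h
  omega

/-- The same count, where `c` now contributes an extra `deg c - 2`. -/
theorem numLeaves_eq_deg [Finite V] (hG : G.IsTree) {c : V} (hc : 3 ≤ deg G c)
    (hlow : ∀ v, v ≠ c → deg G v ≤ 2) : numLeaves G = deg G c := by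
  classical
  have := Fintype.ofFinite V
  have hV : 2 ≤ Nat.card V := by
    have : (G.neighborSet c).ncard ≤ Nat.card V := Set.ncard_le_card _
    rw [deg] at hc; omega
  have h := sum_deg_sub_two hG
  have h2 : ∑ v, ((deg G v : ℤ) - 2) = ∑ v, (-(if deg G v = 1 then (1 : ℤ) else 0) +
      if v = c then ((deg G c : ℤ) - 2) else 0) := by
    refine Finset.sum_congr rfl fun v _ => ?_
    have := deg_pos_of_connected hG.connected hV v
    have := hlow v
    by_cases hv : v = c
    · subst hv
      simp; omega
    · rw [if_neg hv]
      split_ifs <;> grind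
  rw [h2, Finset.sum_add_distrib, Finset.sum_neg_distrib, ← numLeaves_eq_sum] at h
  simp at h
  omega

/-- The leaf formula for trees with at most one vertex of degree at least `3`. -/
theorem numLeaves_sub_two_of_atMostOne [Finite V] (hG : G.IsTree) (hV : 2 ≤ Nat.card V)
    (h1 : ∀ x y : V, 3 ≤ deg G x → 3 ≤ deg G y → x = y) :
    (numLeaves G : ℤ) - 2 = (numEdges G : ℤ) - (twoMatchingNumber G : ℤ) := by
  obtain ⟨M, hM, hMc⟩ := exists_twoMatching_ncard_eq G
  by_cases h : ∃ c, 3 ≤ deg G c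
  · obtain ⟨c, hc⟩ := h
    have hlow : ∀ v, v ≠ c → deg G v ≤ 2 := fun v hv => by
      by_contra hv'
      exact hv (h1 v c (by omega) hc)
    obtain ⟨w, hw⟩ : (G.neighborSet c).Nonempty := by
      refine Set.nonempty_of_ncard_ne_zero ?_
      rw [deg] at hc; omega
    obtain ⟨N, hN, -, hNc⟩ := exists_twoMatching_avoiding hc hlow hw
    have := twoMatching_ncard_le hN
    have := hM.ncard_add_deg_le c
    rw [numLeaves_eq_deg hG hc hlow]
    omega
  · have hlow : ∀ v, deg G v ≤ 2 := fun v => by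
      by_contra hv'
      exact h ⟨v, by omega⟩
    have hE : IsTwoMatching G G.edgeSet := ⟨subset_rfl, fun v =>
      (encard_le_two_iff _).2 ((ncard_incident_le_deg subset_rfl v).trans (hlow v))⟩
    have := twoMatching_ncard_le hE
    have : M.ncard ≤ G.edgeSet.ncard := Set.ncard_le_ncard hM.1 (Set.toFinite _)
    rw [numLeaves_eq_two hG hV hlow, numEdges]
    omega

end TwoMatching

/-! ### Degrees, edges, `2`-matchings and leaves of a merge -/

section Merge

variable {V A B : Type u} {S : SimpleGraph A} {T' : SimpleGraph B} {vs : A} {vt : B}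
  {f : A ↪ V} {g : B ↪ V}

theorem neighborSet_map_sup_left (hfg : ∀ a b, f a = g b ↔ a = vs ∧ b = vt) {a : A}
    (ha : a ≠ vs) : (S.map f ⊔ T'.map g).neighborSet (f a) = f '' S.neighborSet a := by
  ext x
  simp only [SimpleGraph.mem_neighborSet, SimpleGraph.sup_adj, SimpleGraph.map_adj, Set.mem_image]
  constructor
  · rintro (⟨p, q, h, hp, rfl⟩ | ⟨p, q, h, hp, rfl⟩)
    · rw [f.injective hp] at h
      exact ⟨q, h, rfl⟩
    · exact absurd ((hfg _ _).1 hp.symm).1 ha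
  · rintro ⟨q, h, rfl⟩
    exact Or.inl ⟨a, q, h, rfl, rfl⟩

theorem neighborSet_map_sup_merged (hfg : ∀ a b, f a = g b ↔ a = vs ∧ b = vt) :
    (S.map f ⊔ T'.map g).neighborSet (f vs) =
      f '' S.neighborSet vs ∪ g '' T'.neighborSet vt := by
  have hv : f vs = g vt := (hfg _ _).2 ⟨rfl, rfl⟩
  ext x
  simp only [SimpleGraph.mem_neighborSet, SimpleGraph.sup_adj, SimpleGraph.map_adj, Set.mem_image,
    Set.mem_union]
  constructor
  · rintro (⟨p, q, h, hp, rfl⟩ | ⟨p, q, h, hp, rfl⟩)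
    · rw [f.injective hp] at h
      exact Or.inl ⟨q, h, rfl⟩
    · rw [hv] at hp
      rw [g.injective hp] at h
      exact Or.inr ⟨q, h, rfl⟩
  · rintro (⟨q, h, rfl⟩ | ⟨q, h, rfl⟩)
    · exact Or.inl ⟨vs, q, h, rfl, rfl⟩
    · exact Or.inr ⟨vt, q, h, hv.symm, rfl⟩

theorem deg_map_sup_left (hfg : ∀ a b, f a = g b ↔ a = vs ∧ b = vt) {a : A} (ha : a ≠ vs) :
    deg (S.map f ⊔ T'.map g) (f a) = deg S a := by
  rw [deg, neighborSet_map_sup_left hfg ha, Set.ncard_image_of_injective _ f.injective, deg]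

theorem deg_map_sup_right (hfg : ∀ a b, f a = g b ↔ a = vs ∧ b = vt) {b : B} (hb : b ≠ vt) :
    deg (S.map f ⊔ T'.map g) (g b) = deg T' b := by
  rw [sup_comm]
  exact deg_map_sup_left (vs := vt) (vt := vs) (fun b a => by rw [eq_comm, hfg, and_comm]) hb

theorem deg_map_sup_merged [Finite A] [Finite B] (hfg : ∀ a b, f a = g b ↔ a = vs ∧ b = vt) :
    deg (S.map f ⊔ T'.map g) (f vs) = deg S vs + deg T' vt := by
  rw [deg, neighborSet_map_sup_merged hfg, Set.ncard_union_eq ?_ (Set.toFinite _) (Set.toFinite _),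
    Set.ncard_image_of_injective _ f.injective, Set.ncard_image_of_injective _ g.injective, deg, deg]
  rw [Set.disjoint_left]
  rintro _ ⟨a, ha, rfl⟩ ⟨b, hb, h⟩
  rw [((hfg a b).1 h.symm).1] at ha
  exact S.loopless.irrefl _ ha

/-- A common edge would have two distinct endpoints in both copies, which share only one vertex. -/
theorem disjoint_image_edges (hfg : ∀ a b, f a = g b ↔ a = vs ∧ b = vt) {M : Set (Sym2 A)}
    {N : Set (Sym2 B)} (hM : M ⊆ S.edgeSet) :
    Disjoint (f.sym2Map '' M) (g.sym2Map '' N) := by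
  rw [Set.disjoint_left]
  rintro _ ⟨e, he, rfl⟩ ⟨e', -, h⟩
  induction e with | h x y =>
  induction e' with | h x' y' =>
  have hxy : x ≠ y := (hM he : S.Adj x y).ne
  simp only [Function.Embedding.sym2Map_apply, Sym2.map_mk, Sym2.eq_iff] at h
  rcases h with ⟨h1, h2⟩ | ⟨h1, h2⟩
  · exact hxy (((hfg _ _).1 h1.symm).1.trans ((hfg _ _).1 h2.symm).1.symm)
  · exact hxy (((hfg _ _).1 h2.symm).1.trans ((hfg _ _).1 h1.symm).1.symm)

theorem ncard_image_edges_union [Finite A] [Finite B]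
    (hfg : ∀ a b, f a = g b ↔ a = vs ∧ b = vt) {M : Set (Sym2 A)}
    {N : Set (Sym2 B)} (hM : M ⊆ S.edgeSet) :
    (f.sym2Map '' M ∪ g.sym2Map '' N).ncard = M.ncard + N.ncard := by
  rw [Set.ncard_union_eq (disjoint_image_edges hfg hM) (Set.toFinite _) (Set.toFinite _),
    Set.ncard_image_of_injective _ f.sym2Map.injective,
    Set.ncard_image_of_injective _ g.sym2Map.injective]

theorem numEdges_map_sup [Finite A] [Finite B] (hfg : ∀ a b, f a = g b ↔ a = vs ∧ b = vt) :
    numEdges (S.map f ⊔ T'.map g) = numEdges S + numEdges T' := by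
  rw [numEdges, SimpleGraph.edgeSet_sup, SimpleGraph.edgeSet_map, SimpleGraph.edgeSet_map,
    ncard_image_edges_union hfg subset_rfl, numEdges, numEdges]

theorem IsTwoMatching.preimage {G : SimpleGraph V} {H : SimpleGraph A} {M : Set (Sym2 V)}
    (hM : IsTwoMatching G M) (f : A ↪ V) :
    IsTwoMatching H (H.edgeSet ∩ f.sym2Map ⁻¹' M) := by
  refine ⟨Set.inter_subset_left, fun a => le_trans ?_ (hM.2 (f a))⟩
  refine Set.encard_le_encard_of_injOn (f := f.sym2Map) ?_ f.sym2Map.injective.injOn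
  exact fun e he => ⟨he.1.2, Sym2.mem_map.2 ⟨a, he.2, rfl⟩⟩

theorem exists_twoMatching_parts [Finite A] [Finite B]
    (hfg : ∀ a b, f a = g b ↔ a = vs ∧ b = vt) {M : Set (Sym2 V)}
    (hM : IsTwoMatching (S.map f ⊔ T'.map g) M) :
    ∃ MS MT, IsTwoMatching S MS ∧ IsTwoMatching T' MT ∧ M.ncard = MS.ncard + MT.ncard := by
  refine ⟨_, _, hM.preimage f, hM.preimage g, ?_⟩
  rw [← ncard_image_edges_union hfg Set.inter_subset_left]
  congr 1
  ext e
  constructor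
  · intro he
    have h := hM.1 he
    rw [SimpleGraph.edgeSet_sup, SimpleGraph.edgeSet_map, SimpleGraph.edgeSet_map] at h
    rcases h with ⟨x, hx, rfl⟩ | ⟨x, hx, rfl⟩
    · exact Or.inl ⟨x, ⟨hx, he⟩, rfl⟩
    · exact Or.inr ⟨x, ⟨hx, he⟩, rfl⟩
  · rintro (⟨x, hx, rfl⟩ | ⟨x, hx, rfl⟩) <;> exact hx.2

theorem encard_incident_image_le {M : Set (Sym2 A)} {a : A} (f : A ↪ V)
    (hM : {e ∈ M | a ∈ e}.encard ≤ 2) : {e ∈ f.sym2Map '' M | f a ∈ e}.encard ≤ 2 := by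
  refine le_trans ?_ hM
  rw [← f.sym2Map.injective.encard_image]
  refine Set.encard_le_encard ?_
  rintro _ ⟨⟨e, he, rfl⟩, h⟩
  obtain ⟨a', ha', h⟩ := Sym2.mem_map.1 h
  rw [f.injective h] at ha'
  exact ⟨e, ⟨he, ha'⟩, rfl⟩

/-- `2`-matchings of the two parts of a merge, one of which avoids the merged vertex, combine to a
`2`-matching. -/
theorem IsTwoMatching.union (hfg : ∀ a b, f a = g b ↔ a = vs ∧ b = vt)
    (hr : Set.range f ∪ Set.range g = Set.univ) {M : Set (Sym2 A)} {N : Set (Sym2 B)}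
    (hM : IsTwoMatching S M) (hN : IsTwoMatching T' N) (hvs : ∀ e ∈ M, vs ∉ e) :
    IsTwoMatching (S.map f ⊔ T'.map g) (f.sym2Map '' M ∪ g.sym2Map '' N) := by
  refine ⟨?_, fun v => ?_⟩
  · rw [SimpleGraph.edgeSet_sup, SimpleGraph.edgeSet_map, SimpleGraph.edgeSet_map]
    exact Set.union_subset_union (Set.image_mono hM.1) (Set.image_mono hN.1)
  by_cases hv : v ∈ Set.range g
  · obtain ⟨b, rfl⟩ := hv
    refine le_trans (Set.encard_le_encard ?_) (encard_incident_image_le g (hN.2 b))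
    rintro _ ⟨⟨e, he, rfl⟩ | he, h⟩
    · obtain ⟨a, ha, h⟩ := Sym2.mem_map.1 h
      rw [((hfg _ _).1 h).1] at ha
      exact absurd ha (hvs e he)
    · exact ⟨he, h⟩
  · obtain ⟨a, rfl⟩ : v ∈ Set.range f := by
      have := hr ▸ Set.mem_univ v
      exact this.resolve_right hv
    refine le_trans (Set.encard_le_encard ?_) (encard_incident_image_le f (hM.2 a))
    rintro _ ⟨he | ⟨e, he, rfl⟩, h⟩
    · exact ⟨he, h⟩
    · obtain ⟨b, -, h⟩ := Sym2.mem_map.1 h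
      exact absurd ⟨b, h⟩ hv

open Classical in
/-- The leaves of a merge at a leaf `vs` of the first part. -/
theorem numLeaves_map_sup [Finite A] [Finite B] (hfg : ∀ a b, f a = g b ↔ a = vs ∧ b = vt)
    (hr : Set.range f ∪ Set.range g = Set.univ) (hvs : deg S vs = 1) (hvt : 1 ≤ deg T' vt) :
    numLeaves (S.map f ⊔ T'.map g) + 1 + (if 1 < deg T' vt then 0 else 1) =
      numLeaves S + numLeaves T' := by
  have hmer := deg_map_sup_merged (S := S) (T' := T') hfg
  have hv : f vs = g vt := (hfg _ _).2 ⟨rfl, rfl⟩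
  have h1 : {v | deg (S.map f ⊔ T'.map g) v = 1} =
      f '' ({a | deg S a = 1} \ {vs}) ∪ g '' ({b | deg T' b = 1} \ {vt}) := by
    ext v
    constructor
    · intro hd
      rcases (hr ▸ Set.mem_univ v : v ∈ Set.range f ∪ Set.range g) with ⟨a, rfl⟩ | ⟨b, rfl⟩
      -- The merged vertex has degree `1 + deg vt ≥ 2`, so it is never a leaf.
      · by_cases ha : a = vs
        · subst ha
          simp only [Set.mem_ofPred_eq] at hd
          omega
        · refine Or.inl ⟨a, ⟨?_, ha⟩, rfl⟩
          rwa [Set.mem_ofPred_eq, deg_map_sup_left hfg ha] at hd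
      · by_cases hb : b = vt
        · subst hb
          simp only [Set.mem_ofPred_eq, ← hv] at hd
          omega
        · refine Or.inr ⟨b, ⟨?_, hb⟩, rfl⟩
          rwa [Set.mem_ofPred_eq, deg_map_sup_right hfg hb] at hd
    · rintro (⟨a, ⟨ha, hne⟩, rfl⟩ | ⟨b, ⟨hb, hne⟩, rfl⟩)
      · exact (deg_map_sup_left hfg hne).trans ha
      · exact (deg_map_sup_right hfg hne).trans hb
  have hdisj : Disjoint (f '' ({a | deg S a = 1} \ {vs})) (g '' ({b | deg T' b = 1} \ {vt})) := by
    rw [Set.disjoint_left]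
    rintro _ ⟨a, ha, rfl⟩ ⟨b, hb, h⟩
    exact ha.2 ((hfg _ _).1 h.symm).1
  have h2 : numLeaves (S.map f ⊔ T'.map g) =
      ({a | deg S a = 1} \ {vs}).ncard + ({b | deg T' b = 1} \ {vt}).ncard := by
    rw [numLeaves, h1, Set.ncard_union_eq hdisj (Set.toFinite _) (Set.toFinite _),
      Set.ncard_image_of_injective _ f.injective, Set.ncard_image_of_injective _ g.injective]
  have h3 : ({a | deg S a = 1} \ {vs}).ncard + 1 = numLeaves S :=
    Set.ncard_sdiff_singleton_add_one hvs (Set.toFinite _)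
  split_ifs with h
  · have : ({b | deg T' b = 1} \ {vt}).ncard = numLeaves T' := by
      rw [Set.sdiff_singleton_eq_self (by simp; omega), numLeaves]
    omega
  · have : ({b | deg T' b = 1} \ {vt}).ncard + 1 = numLeaves T' :=
      Set.ncard_sdiff_singleton_add_one (by simp; omega) (Set.toFinite _)
    omega

end Merge

/-! ### Effect of a splitting, and the formula for every decomposition -/

section Splitting

variable {V : Type u} {T : SimpleGraph V}

theorem StarlikeSplitting.finite_left [Finite V] (σ : StarlikeSplitting T) : Finite σ.A := by
  obtain ⟨f, -⟩ := σ.isMerge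
  exact Finite.of_injective f f.injective

theorem StarlikeSplitting.finite_right [Finite V] (σ : StarlikeSplitting T) : Finite σ.B := by
  obtain ⟨-, g, -⟩ := σ.isMerge
  exact Finite.of_injective g g.injective

/-- If `T'` were a single vertex, `T` would be a copy of `S` and have only one vertex of degree at
least `3`. This gives `deg vt ≥ 1` and keeps the size hypothesis through the induction. -/
theorem StarlikeSplitting.two_le_card_right [Finite V] (σ : StarlikeSplitting T) :
    2 ≤ Nat.card σ.B := by
  have := σ.finite_left
  have := σ.finite_right
  by_contra hlt
  have hsub : Subsingleton σ.B := Finite.card_le_one_iff_subsingleton.1 (by omega)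
  obtain ⟨x, y, hxy, hx, hy⟩ := σ.exists_two_high
  obtain ⟨f, g, hfg, hr, hT⟩ := σ.isMerge
  have h0 : deg σ.T' σ.vt = 0 := by
    rw [deg, Set.ncard_eq_zero (Set.toFinite _), Set.eq_empty_iff_forall_notMem]
    exact fun b hb => (hb : σ.T'.Adj σ.vt b).ne (Subsingleton.elim _ _)
  have hdeg : ∀ v, deg T v = deg (σ.S.map f ⊔ σ.T'.map g) v := fun v => congrArg (deg · v) hT
  have key : ∀ v, 3 ≤ deg T v → ∃ a, f a = v ∧ 3 ≤ deg σ.S a := by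
    intro v hv
    obtain ⟨a, rfl⟩ : v ∈ Set.range f := by
      rcases (hr ▸ Set.mem_univ v : v ∈ Set.range f ∪ Set.range g) with h | ⟨b, rfl⟩
      · exact h
      · exact ⟨σ.vs, (hfg _ _).2 ⟨rfl, Subsingleton.elim _ _⟩⟩
    refine ⟨a, rfl, ?_⟩
    rw [hdeg] at hv
    by_cases ha : a = σ.vs
    · rw [ha, deg_map_sup_merged hfg, h0] at hv
      rwa [ha]
    · rwa [deg_map_sup_left hfg ha] at hv
  obtain ⟨a, rfl, ha⟩ := key x hx
  obtain ⟨b, rfl, hb⟩ := key y hy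
  exact hxy (congrArg f (σ.isStarlike.2.unique ha hb))

open Classical in
/-- How a starlike splitting changes the leaf number and the deficiency `|E| - ν₂`. -/
theorem StarlikeSplitting.deficiency_eq [Finite V] (σ : StarlikeSplitting T) :
    ((numEdges T : ℤ) - twoMatchingNumber T) - (numEdges σ.T' - twoMatchingNumber σ.T') =
      (numLeaves T : ℤ) - numLeaves σ.T' - (if σ.IsIrregular then 1 else 0) := by
  have := σ.finite_left
  have := σ.finite_right
  have hvt := deg_pos_of_connected σ.isTree.connected σ.two_le_card_right σ.vt
  obtain ⟨f, g, hfg, hr, hT⟩ := σ.isMerge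
  obtain ⟨c, hc, hadj⟩ := σ.adj_center
  have hlow : ∀ v, v ≠ c → deg σ.S v ≤ 2 := fun v hv => by
    by_contra hv'
    exact hv (σ.isStarlike.2.unique (by omega) hc)
  have hE : numEdges T = numEdges σ.S + numEdges σ.T' := by
    conv_lhs => rw [hT]
    exact numEdges_map_sup hfg
  have hL := numLeaves_map_sup hfg hr σ.deg_vs hvt
  rw [← hT, numLeaves_eq_deg σ.isStarlike.1 hc hlow] at hL
  obtain ⟨M, hM, hMc⟩ := exists_twoMatching_ncard_eq T
  rw [hT] at hM
  obtain ⟨MS, MT, hMS, hMT, hMM⟩ := exists_twoMatching_parts hfg hM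
  have hup1 := hMS.ncard_add_deg_le c
  have hup2 := twoMatching_ncard_le hMT
  obtain ⟨N, hN, hNw, hNc⟩ := exists_twoMatching_avoiding hc hlow hadj.symm
  obtain ⟨K, hK, hKc⟩ := exists_twoMatching_ncard_eq σ.T'
  -- The leaf `vs` has only the edge to `c`, which `N` omits.
  have hNvs : ∀ e ∈ N, σ.vs ∉ e := by
    intro e he hve
    have h1 := σ.deg_vs
    rw [deg_eq_ncard_incidenceSet, Set.ncard_eq_one] at h1
    obtain ⟨e₀, h1⟩ := h1
    have h2 : e ∈ σ.S.incidenceSet σ.vs := ⟨hN.1 he, hve⟩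
    have h3 : s(c, σ.vs) ∈ σ.S.incidenceSet σ.vs := ⟨hadj.symm, by simp⟩
    rw [h1] at h2 h3
    rw [Set.mem_singleton_iff.1 h2, ← Set.mem_singleton_iff.1 h3] at he
    exact hNw he
  have hlo := twoMatching_ncard_le (hN.union hfg hr hK hNvs)
  rw [← hT, ncard_image_edges_union hfg hN.1] at hlo
  have hir : σ.IsIrregular ↔ 1 < deg σ.T' σ.vt := Iff.rfl
  by_cases h : 1 < deg σ.T' σ.vt
  · rw [if_pos h] at hL
    rw [if_pos (hir.2 h)]
    omega
  · rw [if_neg h] at hL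
    rw [if_neg (mt hir.1 h)]
    omega

theorem StarlikeDecomposition.numIrregular_eq {V : Type u} {T : SimpleGraph V}
    (D : StarlikeDecomposition T) (hfin : Finite V) (hV : 2 ≤ Nat.card V) :
    (numLeaves T : ℤ) - 2 - D.numIrregular = (numEdges T : ℤ) - twoMatchingNumber T := by
  induction D with
  | last hT h1 =>
    rw [StarlikeDecomposition.numIrregular]
    simpa using numLeaves_sub_two_of_atMostOne hT hV h1
  | split hT σ D ih =>
    have h1 := ih σ.finite_right σ.two_le_card_right
    have h2 := σ.deficiency_eq
    rw [StarlikeDecomposition.numIrregular]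
    push_cast
    linarith

end Splitting

/-! ### Existence of decompositions -/

section Existence

variable {V : Type u} {T : SimpleGraph V}

theorem deg_induce_of_neighborSet_subset (G : SimpleGraph V) {s : Set V} (v : s)
    (h : G.neighborSet v ⊆ s) : deg (G.induce s) v = deg G v := by
  rw [deg, deg, ← Set.ncard_image_of_injective _ Subtype.val_injective]
  congr 1
  ext x
  constructor
  · rintro ⟨y, hy, rfl⟩
    exact hy
  · exact fun hx => ⟨⟨x, h hx⟩, hx, rfl⟩

/-- The vertices on the side of `c` once the edge `cw` is removed. -/
def edgeSide (T : SimpleGraph V) (c w : V) : Set V :=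
  {x | (T.deleteEdges {s(c, w)}).Reachable c x}

theorem mem_edgeSide_self (T : SimpleGraph V) (c w : V) : c ∈ edgeSide T c w :=
  SimpleGraph.Reachable.refl _

theorem edgeSide_connected (T : SimpleGraph V) (c w : V) :
    (T.induce (edgeSide T c w)).Connected := by
  have h : edgeSide T c w =
      ((T.deleteEdges {s(c, w)}).connectedComponentMk c).supp := by
    ext x
    exact ⟨fun h => SimpleGraph.ConnectedComponent.sound h.symm,
      fun h => (SimpleGraph.ConnectedComponent.exact h).symm⟩
  have hc := ((T.deleteEdges {s(c, w)}).connectedComponentMk c).connected_toSimpleGraph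
  rw [h]
  exact hc.mono fun x y hxy => (T.deleteEdges_le _) hxy

/-- The only edge leaving the side of `c` is `cw`. -/
theorem edgeSide_boundary {c w x y : V} (hx : x ∈ edgeSide T c w) (hy : y ∉ edgeSide T c w)
    (hxy : T.Adj x y) (hw : w ∉ edgeSide T c w) : x = c ∧ y = w := by
  by_cases h : s(x, y) = s(c, w)
  · rcases Sym2.eq_iff.1 h with h | ⟨rfl, rfl⟩
    · exact h
    · exact absurd hx hw
  · exact absurd (hx.trans (SimpleGraph.Adj.reachable
      (by rw [SimpleGraph.deleteEdges_adj]; exact ⟨hxy, h⟩))) hy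

/-- Every edge of a tree is a bridge, so the sides are disjoint. They cover everything, since a walk
leaving their union would need an edge other than `cw` out of one side. -/
theorem edgeSide_swap (hT : T.IsTree) {c w : V} (h : T.Adj c w) :
    edgeSide T w c = (edgeSide T c w)ᶜ := by
  have hb : ¬ (T.deleteEdges {s(c, w)}).Reachable c w :=
    SimpleGraph.isAcyclic_iff_forall_adj_isBridge.1 hT.isAcyclic h
  ext x
  simp only [edgeSide, Sym2.eq_swap (a := w), Set.mem_compl_iff, Set.mem_ofPred_eq]
  constructor
  · exact fun h1 h2 => hb (h2.trans h1.symm)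
  · intro hx
    by_contra hx'
    obtain ⟨p⟩ := hT.connected.preconnected c x
    obtain ⟨⟨⟨a, b⟩, hab⟩, -, ha, hb'⟩ := p.exists_boundary_dart
      (edgeSide T c w ∪ edgeSide T w c) (Or.inl (mem_edgeSide_self T c w))
      (by simp only [edgeSide, Sym2.eq_swap (a := w)]; exact fun h => h.elim hx hx')
    simp only [Set.mem_union, not_or] at ha hb'
    rcases ha with ha | ha
    · have := edgeSide_boundary ha hb'.1 hab hb
      exact hb'.2 (this.2 ▸ mem_edgeSide_self T w c)
    · have := edgeSide_boundary ha hb'.2 hab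
        (by simp only [edgeSide, Sym2.eq_swap (a := w)]; exact fun h => hb h.symm)
      exact hb'.1 (this.2 ▸ mem_edgeSide_self T c w)

/-- A tree with two vertices of degree at least `3` has an edge `cw` such that `c` is the only
such vertex on its side. -/
theorem exists_extremal_edge [Finite V] (hT : T.IsTree) {x y : V} (hxy : x ≠ y)
    (hx : 3 ≤ deg T x) (hy : 3 ≤ deg T y) :
    ∃ c w, T.Adj c w ∧ 3 ≤ deg T c ∧ ∀ v ∈ edgeSide T c w, 3 ≤ deg T v → v = c := by
  -- Take `c` farthest from `x` among the vertices of degree at least `3`, and `w` next on the path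
  -- from `c` to `x`.
  obtain ⟨c, hc, hmax⟩ := Set.exists_max_image {v | 3 ≤ deg T v} (T.dist x) (Set.toFinite _) ⟨x, hx⟩
  have hcx : c ≠ x := by
    rintro rfl
    have h1 := hmax y hy
    have h2 := hT.connected.pos_dist_of_ne hxy
    rw [SimpleGraph.dist_self] at h1
    omega
  obtain ⟨p, hp⟩ := hT.connected.exists_isPath c x
  cases p with
  | nil => exact absurd rfl hcx
  | @cons _ w _ h q =>
    have hcq : c ∉ q.support := ((SimpleGraph.Walk.cons_isPath_iff _ _).1 hp).2
    have hxw : x ∈ edgeSide T w c := by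
      refine ⟨q.toDeleteEdge _ fun he => hcq ?_⟩
      rw [Sym2.eq_swap] at he
      exact q.fst_mem_support_of_mem_edges he
    have hwn : w ∉ edgeSide T c w := by
      have := mem_edgeSide_self T w c
      rwa [edgeSide_swap hT h] at this
    rw [edgeSide_swap hT h] at hxw
    refine ⟨c, w, h, hc, fun v hv hdv => ?_⟩
    by_contra hvc
    -- A shortest walk from `v` to `x` leaves the side of `c` through `c`, so `v ≠ c` would be
    -- strictly farther from `x` than `c`.
    obtain ⟨r, hr⟩ := hT.connected.exists_walk_length_eq_dist v x
    obtain ⟨⟨⟨a, b⟩, hab⟩, hd, ha, hb⟩ := r.exists_boundary_dart _ hv hxw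
    have hac : a = c := (edgeSide_boundary ha hb hab hwn).1
    have hcr : c ∈ r.support := hac ▸ r.dart_fst_mem_support_of_mem_darts hd
    classical
    have hlen := congrArg SimpleGraph.Walk.length (r.take_spec hcr)
    rw [SimpleGraph.Walk.length_append] at hlen
    have h1 := SimpleGraph.dist_le (r.dropUntil c hcr)
    have h2 := SimpleGraph.dist_le (r.takeUntil c hcr)
    have h3 := hT.connected.pos_dist_of_ne hvc
    have h4 := hmax v hdv
    rw [T.dist_comm (u := x), T.dist_comm (u := x)] at h4
    omega

/-- Cut at an extremal edge `cw`: `S` is the side of `c` together with `w`, `T'` is the side of `w`,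
and both `vs` and `vt` are `w`. -/
theorem exists_starlikeSplitting [Finite V] (hT : T.IsTree) {x y : V} (hxy : x ≠ y)
    (hx : 3 ≤ deg T x) (hy : 3 ≤ deg T y) :
    ∃ σ : StarlikeSplitting T, Nat.card σ.B < Nat.card V := by
  obtain ⟨c, w, hcw, hc, huniq⟩ := exists_extremal_edge hT hxy hx hy
  have hswap := edgeSide_swap hT hcw
  have hcC := mem_edgeSide_self T c w
  have hwC : w ∈ (edgeSide T c w)ᶜ := hswap ▸ mem_edgeSide_self T w c
  set C := edgeSide T c w with hC
  have hcA : c ∈ C ∪ {w} := Or.inl hcC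
  have hwA : w ∈ C ∪ {w} := Or.inr (Set.mem_singleton w)
  have hbd : ∀ {a b}, a ∈ C → b ∉ C → T.Adj a b → a = c ∧ b = w := fun ha hb hab =>
    edgeSide_boundary ha hb hab hwC
  have hAtree : (T.induce (C ∪ {w})).IsTree := by
    refine ⟨SimpleGraph.connected_induce_union (edgeSide_connected T c w).preconnected ?_ hcC
      (Set.mem_singleton w) hcw, hT.isAcyclic.induce _⟩
    exact SimpleGraph.Preconnected.of_subsingleton
  have hBtree : (T.induce Cᶜ).IsTree :=
    ⟨hswap ▸ edgeSide_connected T w c, hT.isAcyclic.induce _⟩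
  have hdegC : ∀ v : (C ∪ {w} : Set V), (v : V) ∈ C → deg (T.induce (C ∪ {w})) v = deg T v := by
    intro v hv
    refine deg_induce_of_neighborSet_subset T v fun z hz => ?_
    by_cases hzC : z ∈ C
    · exact Or.inl hzC
    · exact Or.inr (hbd hv hzC hz).2
  have hdegw : deg (T.induce (C ∪ {w})) ⟨w, hwA⟩ = 1 := by
    rw [deg, Set.ncard_eq_one]
    refine ⟨⟨c, hcA⟩, ?_⟩
    ext ⟨z, hz⟩
    rw [Set.mem_singleton_iff, Subtype.mk.injEq]
    constructor
    · intro h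
      replace h : T.Adj w z := h
      rcases hz with hz | rfl
      · exact (hbd hz hwC h.symm).1
      · exact absurd h (T.loopless.irrefl _)
    · rintro rfl
      exact hcw.symm
  refine ⟨{ A := (C ∪ {w} : Set V), B := (Cᶜ : Set V), S := T.induce (C ∪ {w}), T' := T.induce Cᶜ,
            vs := ⟨w, hwA⟩, vt := ⟨w, hwC⟩, exists_two_high := ⟨x, y, hxy, hx, hy⟩,
            isStarlike := ⟨hAtree, ⟨c, hcA⟩, ?_, ?_⟩, isTree := hBtree, deg_vs := hdegw,
            adj_center := ⟨⟨c, hcA⟩, ?_, hcw.symm⟩, isMerge := ?_ }, ?_⟩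
  · exact hc.trans_eq (hdegC ⟨c, hcA⟩ hcC).symm
  · rintro ⟨v, hv⟩ hdv
    rcases hv with hvC | rfl
    · rw [hdegC _ hvC] at hdv
      exact Subtype.ext (huniq v hvC hdv)
    · rw [hdegw] at hdv
      omega
  · exact hc.trans_eq (hdegC ⟨c, hcA⟩ hcC).symm
  · refine ⟨Function.Embedding.subtype _, Function.Embedding.subtype _, ?_, ?_, ?_⟩
    · rintro ⟨a, ha⟩ ⟨b, hb⟩
      change a = b ↔ (⟨a, ha⟩ : (C ∪ {w} : Set V)) = ⟨w, hwA⟩ ∧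
        (⟨b, hb⟩ : (Cᶜ : Set V)) = ⟨w, hwC⟩
      rw [Subtype.mk.injEq, Subtype.mk.injEq]
      constructor
      · rintro rfl
        rcases ha with ha | rfl
        · exact absurd ha hb
        · exact ⟨rfl, rfl⟩
      · rintro ⟨rfl, rfl⟩
        rfl
    · ext v
      by_cases hv : v ∈ C <;> simp [hv]
    · ext a b
      simp only [SimpleGraph.sup_adj, SimpleGraph.map_adj]
      constructor
      · intro hab
        by_cases ha : a ∈ C <;> by_cases hb : b ∈ C
        · exact Or.inl ⟨⟨a, Or.inl ha⟩, ⟨b, Or.inl hb⟩, hab, rfl, rfl⟩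
        · exact Or.inl ⟨⟨a, Or.inl ha⟩, ⟨b, Or.inr (hbd ha hb hab).2⟩, hab, rfl, rfl⟩
        · exact Or.inl ⟨⟨a, Or.inr (hbd hb ha hab.symm).2⟩, ⟨b, Or.inl hb⟩, hab, rfl, rfl⟩
        · exact Or.inr ⟨⟨a, ha⟩, ⟨b, hb⟩, hab, rfl, rfl⟩
      · rintro (⟨p, q, h, rfl, rfl⟩ | ⟨p, q, h, rfl, rfl⟩) <;> exact h
  · exact Finite.card_subtype_lt (x := c) (fun h => h hcC)

theorem nonempty_starlikeDecomposition {V : Type u} [Finite V] (T : SimpleGraph V)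
    (hT : T.IsTree) : Nonempty (StarlikeDecomposition T) := by
  induction hn : Nat.card V using Nat.strong_induction_on generalizing V with
  | _ n ih =>
    by_cases h : ∀ x y : V, 3 ≤ deg T x → 3 ≤ deg T y → x = y
    · exact ⟨.last hT h⟩
    · push Not at h
      obtain ⟨x, y, hx, hy, hxy⟩ := h
      obtain ⟨σ, hσ⟩ := exists_starlikeSplitting hT hxy hx hy
      have := σ.finite_right
      obtain ⟨D⟩ := ih _ (hn ▸ hσ) σ.T' σ.isTree rfl
      exact ⟨.split hT σ D⟩

end Existence

end TreeSplitting

theorem proposition5p4 {V : Type u} [Finite V] (T : SimpleGraph V) (hT : T.IsTree)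
    (hV : 2 ≤ Nat.card V) :
    Nonempty (TreeSplitting.StarlikeDecomposition T) ∧
    (∀ D : TreeSplitting.StarlikeDecomposition T,
      D.numIrregular = TreeSplitting.splittingIrregularityNumber T) ∧
    (TreeSplitting.numLeaves T : ℤ) - 2 - (TreeSplitting.splittingIrregularityNumber T : ℤ) =
      (TreeSplitting.numEdges T : ℤ) - (TreeSplitting.twoMatchingNumber T : ℤ) := by
  obtain ⟨D₀⟩ := TreeSplitting.nonempty_starlikeDecomposition T hT
  -- Since a decomposition exists, the infimum is attained rather than the default value `0`.
  obtain ⟨D₁, hD₁⟩ : TreeSplitting.splittingIrregularityNumber T ∈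
      Set.range fun D : TreeSplitting.StarlikeDecomposition T => D.numIrregular :=
    Nat.sInf_mem ⟨_, D₀, rfl⟩
  beta_reduce at hD₁
  have h₁ := D₁.numIrregular_eq ‹_› hV
  rw [← hD₁]
  refine ⟨⟨D₀⟩, fun D => ?_, h₁⟩
  have h := D.numIrregular_eq ‹_› hV
  omega
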